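/- Let $K$ be a number field with ring of integers $\mathcal{O}$, let $n\ge 3$, and assume that the group of units $\mathcal{O}^\times$ is finite, generated by $\alpha_1,\dots,\alpha_r$. Let $\beta_1,\dots,\beta_m$ be a basis of $\mathcal{O}$ as a $\mathbb{Z}$-module. Let $G=\mathrm{T}_n(\mathcal{O})$ be the group of all invertible upper triangular $n\times n$ matrices over $\mathcal{O}$; let $\bar t(\bar\beta)$ be the tuple of all transvections $t_{kl}(\beta_i)=\mathbf{1}+\beta_i e_{kl}$ ($1\le k<l\le n$, $1\le i\le m$) and $\bar d(\bar\alpha)$ the tuple of all dilations $d_k(\alpha_j)=\mathrm{diag}[1,\dots,\alpha_j,\dots,1]$ with $\alpha_j$ in the $k$-th place ($1\le k\le n$, $1\le j\le r$). Then the ring $\mathcal{O}$ (in the language of unital rings) is bi-interpretable with $(G,\bar t(\bar\beta),\bar d(\bar\alpha))$, that is, with the group $G$ (in the language of groups) where the parameters $\bar t(\bar\beta),\bar d(\bar\alpha)$ may be used in $G$, and no parameters are used in $\mathcal{O}$. Explicitly: there are a first-order interpretation $\Delta$ of the ring $\mathcal{O}$ in the group $G$ with parameters $\bar t(\bar\beta),\bar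 d(\bar\alpha)$, and a parameter-free first-order interpretation $\Gamma$ of the group $G$ in the ring $\mathcal{O}$, such that, if $\tilde{\mathcal{O}}$ denotes the copy of $\mathcal{O}$ inside $\mathcal{O}$ and $\tilde G$ the copy of $G$ inside $G$ obtained by composing the two interpretations, there is an isomorphism $\mathcal{O}\cong\tilde{\mathcal{O}}$ that is first-order definable in $\mathcal{O}$ without parameters, and there is an isomorphism $G\cong\tilde G$ that is first-order definable in $G$ with the parameters $\bar t(\bar\beta),\bar d(\bar\alpha)$. -/

import Mathlib

open FirstOrder

/-! ## The first-order language of groups -/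

/-- The function symbols of the first-order language of groups. -/
inductive GroupFunc : ℕ → Type
  | mul : GroupFunc 2
  | inv : GroupFunc 1
  | one : GroupFunc 0

/-- The first-order language of groups: multiplication, inversion, identity; no relation symbols
(besides equality). -/
def groupLanguage : FirstOrder.Language.{0, 0} where
  Functions := GroupFunc
  Relations := fun _ => Empty

/-- Every group is a structure for the language of groups in the obvious way. -/
instance groupStructure (G : Type*) [Group G] : groupLanguage.Structure G where
  funMap := fun {k} f =>
    match k, f with
    | _, GroupFunc.mul => fun x => x 0 * x 1
    | _, GroupFunc.inv => fun x => (x 0)⁻¹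
    | _, GroupFunc.one => fun _ => 1
  RelMap := fun r _ => r.elim

/-- A ring of integers as a structure for the language of (unital) rings. -/
noncomputable instance ringOfIntegersStructure (K : Type*) [Field K] :
    FirstOrder.Ring.CompatibleRing (NumberField.RingOfIntegers K) :=
  FirstOrder.Ring.compatibleRingOfRing _

/-! ## Interpretations and bi-interpretability -/

/-- A coordinate map: a surjection onto `A` from a set of `ι`-tuples of elements of `B`. The
`ι`-tuples in `dom`, modulo having the same image, form a copy of `A` inside `B`. -/
structure CoordMap (ι : Type*) (B : Type*) (A : Type*) where
  /-- the set of tuples representing elements of `A` -/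
  dom : Set (ι → B)
  /-- the element represented by a tuple -/
  coord : dom → A
  /-- every element is represented -/
  surj : Function.Surjective coord

namespace CoordMap

/-- The copy of `A` carried by a coordinate map: the set of admissible tuples of `B`, modulo the
relation of representing the same element. -/
def Copy {ι B A : Type*} (f : CoordMap ι B A) : Type _ :=
  Quotient (Setoid.ker f.coord)

/-- The point of the copy represented by an admissible tuple. -/
def toCopy {ι B A : Type*} (f : CoordMap ι B A) (x : f.dom) : f.Copy :=
  Quotient.mk (Setoid.ker f.coord) x

/-- The bijection of the copy with `A` induced by the coordinate map. -/
noncomputable def copyEquiv {ι B A : Type*} (f : CoordMap ι B A) : f.Copy ≃ A :=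
  Setoid.quotientKerEquivOfSurjective f.coord f.surj

/-- The copy of an `L`-structure `A` is an `L`-structure: a function symbol (relation symbol) is
interpreted on classes of tuples as it is in `A` on the elements that they represent. -/
noncomputable instance copyStructure {ι B A : Type*} (L : FirstOrder.Language) [L.Structure A]
    (f : CoordMap ι B A) : L.Structure f.Copy :=
  f.copyEquiv.symm.inducedStructure

/-- Composition of coordinate maps: if `κ`-tuples of `C` represent elements of `B`, and `ι`-tuples
of `B` represent elements of `A`, then `ι`-tuples of `κ`-tuples of `C` represent elements
of `A`. -/
def comp {ι κ C B A : Type*} (f : CoordMap ι B A) (g : CoordMap κ C B) :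
    CoordMap (ι × κ) C A where
  dom := {x | ∃ h : ∀ i, (fun j => x (i, j)) ∈ g.dom,
    (fun i => g.coord ⟨fun j => x (i, j), h i⟩) ∈ f.dom}
  coord := fun x =>
    f.coord ⟨fun i => g.coord ⟨fun j => x.1 (i, j), x.2.choose i⟩, x.2.choose_spec⟩
  surj := by
    intro a
    obtain ⟨⟨y, hy⟩, rfl⟩ := f.surj a
    choose z hz using fun i => g.surj (y i)
    have hy' : (fun i => g.coord ⟨fun j => (z i).1 j, (z i).2⟩) = y := funext hz
    refine ⟨⟨fun p => (z p.1).1 p.2, fun i => (z i).2, ?_⟩, ?_⟩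
    · change (fun i => g.coord ⟨fun j => (z i).1 j, (z i).2⟩) ∈ f.dom
      rwa [hy']
    · exact congrArg f.coord (Subtype.ext hy')

/-- `f` is (the coordinate map of) an interpretation of the `L`-structure `A` in the
`L'`-structure `B` with parameters from `Q`: the set of admissible tuples, and the preimages under
`f` of equality, of the graphs of the basic functions and of the basic relations of `A`, are
first-order definable in `B` with parameters from `Q`. -/
structure IsInterpretation (L L' : FirstOrder.Language) {A B : Type*} [L.Structure A] [L'.Structure B]
    (Q : Set B) {d : ℕ} (f : CoordMap (Fin d) B A) : Prop where
  dom_definable : Q.Definable L' f.dom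
  eq_definable : Q.Definable L' {v : Fin d ⊕ Fin d → B |
    ∃ (hx : (fun j => v (Sum.inl j)) ∈ f.dom) (hy : (fun j => v (Sum.inr j)) ∈ f.dom),
      f.coord ⟨_, hx⟩ = f.coord ⟨_, hy⟩}
  fun_definable : ∀ (k : ℕ) (F : L.Functions k),
    Q.Definable L' {v : (Fin k × Fin d) ⊕ Fin d → B |
      ∃ (hx : ∀ i, (fun j => v (Sum.inl (i, j))) ∈ f.dom)
        (hy : (fun j => v (Sum.inr j)) ∈ f.dom),
        FirstOrder.Language.Structure.funMap F (fun i => f.coord ⟨_, hx i⟩) = f.coord ⟨_, hy⟩}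
  rel_definable : ∀ (k : ℕ) (R : L.Relations k),
    Q.Definable L' {v : Fin k × Fin d → B |
      ∃ hx : ∀ i, (fun j => v (i, j)) ∈ f.dom,
        FirstOrder.Language.Structure.RelMap R (fun i => f.coord ⟨_, hx i⟩)}

/-- For a coordinate map from tuples of `A` to `A` itself: there is an isomorphism of `A` with its
copy whose graph is first-order definable in `A` with parameters from `P`. -/
def HasDefinableIso (L : FirstOrder.Language) {A ι : Type*} [L.Structure A] (P : Set A)
    (f : CoordMap ι A A) : Prop :=
  ∃ φ : A ≃[L] f.Copy, P.Definable L {v : Option ι → A |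
    ∃ h : (fun i => v (some i)) ∈ f.dom, φ (v none) = f.toCopy ⟨_, h⟩}

end CoordMap

/-- The `L`-structure `A`, with parameters from `P`, is bi-interpretable with the `L'`-structure
`B`, with parameters from `Q`: there are an interpretation `Δ` of `A` in `B` and an interpretation
`Γ` of `B` in `A` such that `A` is definably isomorphic in `A` to the copy of `A` obtained by
composing the two interpretations, and `B` is definably isomorphic in `B` to the copy of `B`
obtained by composing them in the other order. Definability in `A` is with parameters from `P`,
definability in `B` with parameters from `Q`; in particular `P = ∅` means that no parameters
are used in `A`. -/
def BiInterpretable (L L' : FirstOrder.Language) {A B : Type*} [L.Structure A] [L'.Structure B]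
    (P : Set A) (Q : Set B) : Prop :=
  ∃ (d e : ℕ) (Δ : CoordMap (Fin d) B A) (Γ : CoordMap (Fin e) A B),
    Δ.IsInterpretation L L' Q ∧ Γ.IsInterpretation L' L P ∧
    (Δ.comp Γ).HasDefinableIso L P ∧ (Γ.comp Δ).HasDefinableIso L' Q

/-! ## The group of invertible upper triangular matrices -/

/-- The group `T_n(R)` of all invertible upper triangular `n × n` matrices over `R`. -/
def upperTriangularGroup (n : ℕ) (R : Type*) [CommRing R] : Subgroup (GL (Fin n) R) where
  carrier := {g | (g : Matrix (Fin n) (Fin n) R).IsUpperTriangular}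
  one_mem' := Matrix.blockTriangular_one
  mul_mem' := fun ha hb => Matrix.BlockTriangular.mul ha hb
  inv_mem' := by
    intro g hg
    have : Invertible (g : Matrix (Fin n) (Fin n) R) := g.invertible
    simp only [Set.mem_ofPred_eq, Matrix.coe_units_inv]
    exact Matrix.blockTriangular_inv_of_blockTriangular hg

namespace upperTriangularGroup

/-- The transvection `t_{kl}(b) = 1 + b e_{kl}`, for `k < l`, as an element of `T_n(R)`. -/
def transvection {n : ℕ} {R : Type*} [CommRing R] {k l : Fin n} (hkl : k < l) (b : R) :
    upperTriangularGroup n R :=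
  ⟨Matrix.SpecialLinearGroup.toGL (Matrix.SpecialLinearGroup.transvection hkl.ne b),
    Matrix.blockTriangular_transvection hkl.le b⟩

/-- The dilation `d_k(a) = diag[1, …, a, …, 1]`, with `a` in the `k`-th place, as an element
of `T_n(R)`. -/
def dilation {n : ℕ} {R : Type*} [CommRing R] (k : Fin n) (a : Rˣ) :
    upperTriangularGroup n R :=
  ⟨⟨Matrix.diagonal (Function.update 1 k (a : R)),
    Matrix.diagonal (Function.update 1 k ((a⁻¹ : Rˣ) : R)),
    by
      rw [Matrix.diagonal_mul_diagonal, ← Matrix.diagonal_one]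
      congr 1; ext i; by_cases h : i = k
      · subst h; simp
      · simp [h],
    by
      rw [Matrix.diagonal_mul_diagonal, ← Matrix.diagonal_one]
      congr 1; ext i; by_cases h : i = k
      · subst h; simp
      · simp [h]⟩,
    Matrix.blockTriangular_diagonal _⟩

/-- The set of parameters consisting of all the transvections `t_{kl}(β_i)`, `k < l`, and all the
dilations `d_k(α_j)`. -/
def params (n : ℕ) {R : Type*} [CommRing R] {m r : ℕ} (β : Fin m → R) (α : Fin r → Rˣ) :
    Set (upperTriangularGroup n R) :=
  {g | ∃ (k l : Fin n) (hkl : k < l) (i : Fin m), g = transvection hkl (β i)} ∪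
  {g | ∃ (k : Fin n) (j : Fin r), g = dilation k (α j)}

end upperTriangularGroup

/-! ## Closure properties of definable sets -/

namespace Set

variable {M α β : Type*} {L : FirstOrder.Language} [L.Structure M] {A : Set M}

/-! The parameters generate `G`, because the `β i` span the ring additively and the `α j` generate
its units. Every single element of `G` is therefore a word in the parameters and may be used as a
constant (`closure_params_eq_top`, `Set.DefinableFun.group_const`).

Each one-parameter group `t_{kl}(R)` is definable. An element `h` commuting with `d_i(-1)` for all
`i ≠ k, l` is diagonal apart from its `(k,l)` entry, so its commutator with `d_k(-1)` is some
`t_{kl}(2a)`. All of `t_{kl}(2R)` arises in this way, and finitely many translates of it cover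
`t_{kl}(R)`, since `R/2R` is finite (`definable_mem_range_transvection`).

The ring is then interpreted on the upper right corner. Addition is the group law, and
multiplication comes from `[t_{ij}(a), t_{jk}(b)] = t_{ik}(ab)`, for which `n ≥ 3` is needed
(`definable_corner_mul`). In the other direction a matrix is interpreted by the tuple of its
entries.

Both coordinate maps are injective, so the definable isomorphisms reduce to the definability of the
two composites. Over the ring this is clear: the entries of `t_{1n}(a)` are `0`, `1` and `a`. Over
the group, the map from `g` to its entries, placed in the corner, must be definable. It is so on
each `t_{kl}(R)`, by commutators with constants, and on each set of dilations `d_k`, which is finite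
because there are finitely many units. The property passes to products of sets
(`EntriesDefinable.mul`), and `G` is a product of finitely many of these sets
(`univ_of_mul_closed`). -/

theorem Definable.exists_tuple [Finite β] {P : (α → M) → (β → M) → Prop}
    (h : A.Definable L {u : α ⊕ β → M | P (fun i => u (Sum.inl i)) (fun j => u (Sum.inr j))}) :
    A.Definable L {v : α → M | ∃ w : β → M, P v w} := by
  simpa using! h.exists_of_finite

theorem Definable.exists_elem {P : (α → M) → M → Prop}
    (h : A.Definable L {u : Option α → M | P (fun i => u (some i)) (u none)}) :
    A.Definable L {v : α → M | ∃ x : M, P v x} := by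
  have h' : A.Definable L {v : α → M | ∃ w : Unit → M, P v (w ())} :=
    Definable.exists_tuple
      (h.preimage_comp (fun o : Option α => o.elim (Sum.inr ()) (Sum.inl : α → α ⊕ Unit)))
  convert h' using 3 with v
  exact ⟨fun ⟨x, hx⟩ => ⟨fun _ => x, hx⟩, fun ⟨w, hw⟩ => ⟨w (), hw⟩⟩

theorem Definable.and {P Q : (α → M) → Prop} (hP : A.Definable L {v | P v})
    (hQ : A.Definable L {v | Q v}) : A.Definable L {v | P v ∧ Q v} :=
  hP.inter hQ

theorem Definable.imp_const {P : (α → M) → Prop} (q : Prop) (hP : q → A.Definable L {v | P v}) :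
    A.Definable L {v | q → P v} := by
  by_cases hq : q
  · simpa [hq] using hP hq
  · simp [hq]

theorem Definable.forall_finite {ι : Type*} [Finite ι] {P : ι → (α → M) → Prop}
    (hP : ∀ i, A.Definable L {v | P i v}) : A.Definable L {v | ∀ i, P i v} := by
  rw [ofPred_forall]
  exact definable_iInter_of_finite hP

theorem Definable.exists_finite {ι : Type*} [Finite ι] {P : ι → (α → M) → Prop}
    (hP : ∀ i, A.Definable L {v | P i v}) : A.Definable L {v | ∃ i, P i v} := by
  rw [ofPred_exists]
  exact definable_iUnion_of_finite hP

theorem Definable.subst [Finite β] {P : (β → M) → Prop} (hP : A.Definable L {w | P w})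
    {F : β → (α → M) → M} (hF : ∀ b, A.DefinableFun L (F b)) :
    A.Definable L {v | P fun b => F b v} :=
  hP.preimage_map (F := fun v b => F b v) hF

theorem DefinableFun.funMap {k : ℕ} (f : L.Functions k) {F : Fin k → (α → M) → M}
    (hF : ∀ i, A.DefinableFun L (F i)) :
    A.DefinableFun L fun v => FirstOrder.Language.Structure.funMap f fun i => F i v :=
  DefinableFun.comp (g := fun v i => F i v) hF (DefinableFun.of_empty (DefinableFun.fun_symbol f))

theorem DefinableFun.var (i : α) : A.DefinableFun L fun v : α → M => v i :=
  DefinableFun.proj L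

end Set

/-! ### Definable functions of groups and rings -/

section Group

open scoped commutatorElement

variable {G α : Type*} [Group G] {Q : Set G} {F H : (α → G) → G}

theorem Set.DefinableFun.group_mul (hF : Q.DefinableFun groupLanguage F)
    (hH : Q.DefinableFun groupLanguage H) :
    Q.DefinableFun groupLanguage fun v => F v * H v :=
  Set.DefinableFun.funMap (L := groupLanguage) GroupFunc.mul (F := ![F, H])
    (by simp [Fin.forall_fin_two, hF, hH])

theorem Set.DefinableFun.group_inv (hF : Q.DefinableFun groupLanguage F) :
    Q.DefinableFun groupLanguage fun v => (F v)⁻¹ :=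
  Set.DefinableFun.funMap (L := groupLanguage) GroupFunc.inv (F := ![F])
    (by simp [hF])

theorem Set.DefinableFun.group_one : Q.DefinableFun groupLanguage fun _ : α → G => 1 :=
  Set.DefinableFun.funMap (L := groupLanguage) GroupFunc.one (F := ![])
    (by simp)

theorem Set.DefinableFun.group_prod_ofFn {m : ℕ} {F : Fin m → (α → G) → G}
    (hF : ∀ k, Q.DefinableFun groupLanguage (F k)) :
    Q.DefinableFun groupLanguage fun v => (List.ofFn fun k => F k v).prod := by
  induction m with
  | zero => simpa using Set.DefinableFun.group_one
  | succ m ih =>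
    simp only [List.ofFn_succ, List.prod_cons]
    exact (hF 0).group_mul (ih fun k => hF k.succ)

/-- If the parameters generate the group, every element of it may be used as a parameter. -/
theorem Set.DefinableFun.group_const (hQ : Subgroup.closure Q = ⊤) (c : G) :
    Q.DefinableFun groupLanguage fun _ : α → G => c := by
  have hc : c ∈ Subgroup.closure Q := by rw [hQ]; trivial
  induction hc using Subgroup.closure_induction with
  | mem x hx => exact groupLanguage.definableFun_const α hx
  | one => exact Set.DefinableFun.group_one
  | mul x y _ _ hx hy => exact hx.group_mul hy
  | inv x _ hx => exact hx.group_inv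

theorem Set.DefinableFun.group_commutator (hF : Q.DefinableFun groupLanguage F)
    (hH : Q.DefinableFun groupLanguage H) :
    Q.DefinableFun groupLanguage fun v => ⁅F v, H v⁆ := by
  simp only [commutatorElement_def]
  exact ((hF.group_mul hH).group_mul hF.group_inv).group_mul hH.group_inv

end Group

section Ring

variable {R α : Type*} [CommRing R] [FirstOrder.Ring.CompatibleRing R] {P : Set R}
  {F H : (α → R) → R}

theorem Set.DefinableFun.ring_add (hF : P.DefinableFun FirstOrder.Language.ring F)
    (hH : P.DefinableFun FirstOrder.Language.ring H) :
    P.DefinableFun FirstOrder.Language.ring fun v => F v + H v := by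
  simpa using Set.DefinableFun.funMap FirstOrder.Ring.addFunc (F := ![F, H])
    (A := P) (by simp [Fin.forall_fin_two, hF, hH])

theorem Set.DefinableFun.ring_mul (hF : P.DefinableFun FirstOrder.Language.ring F)
    (hH : P.DefinableFun FirstOrder.Language.ring H) :
    P.DefinableFun FirstOrder.Language.ring fun v => F v * H v := by
  simpa using Set.DefinableFun.funMap FirstOrder.Ring.mulFunc (F := ![F, H])
    (A := P) (by simp [Fin.forall_fin_two, hF, hH])

theorem Set.DefinableFun.ring_zero : P.DefinableFun FirstOrder.Language.ring fun _ : α → R => 0 := by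
  simpa using Set.DefinableFun.funMap FirstOrder.Ring.zeroFunc (F := ![]) (α := α)
    (A := P) (by simp)

theorem Set.DefinableFun.ring_one : P.DefinableFun FirstOrder.Language.ring fun _ : α → R => 1 := by
  simpa using Set.DefinableFun.funMap FirstOrder.Ring.oneFunc (F := ![]) (α := α)
    (A := P) (by simp)

theorem Set.DefinableFun.ring_sum {ι : Type*} (s : Finset ι) {F : ι → (α → R) → R}
    (hF : ∀ i, P.DefinableFun FirstOrder.Language.ring (F i)) :
    P.DefinableFun FirstOrder.Language.ring fun v => ∑ i ∈ s, F i v := by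
  classical
  induction s using Finset.induction_on with
  | empty => simpa using Set.DefinableFun.ring_zero
  | insert i s hi ih =>
    simp only [Finset.sum_insert hi]
    exact (hF i).ring_add ih

end Ring

/-! ## Injective coordinates -/

namespace CoordMap

variable {A B C ι κ : Type*}

/-- The coordinate map given by an injective assignment of tuples to elements. -/
noncomputable def ofInjective (f : A → ι → B) (hf : Function.Injective f) : CoordMap ι B A where
  dom := Set.range f
  coord := (Equiv.ofInjective f hf).symm
  surj := (Equiv.ofInjective f hf).symm.surjective

theorem mem_dom_ofInjective {f : A → ι → B} {hf : Function.Injective f} {x : ι → B} :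
    x ∈ (ofInjective f hf).dom ↔ ∃ a, f a = x :=
  Iff.rfl

theorem coord_ofInjective_eq_iff {f : A → ι → B} {hf : Function.Injective f}
    (x : (ofInjective f hf).dom) (a : A) : (ofInjective f hf).coord x = a ↔ x.1 = f a := by
  exact (Equiv.symm_apply_eq (Equiv.ofInjective f hf)).trans Subtype.ext_iff

/-- Representatives are unique, so the equality relation of the copy is equality of tuples, and only
the domain and the graphs of the function symbols have to be examined. -/
theorem isInterpretation_ofInjective {L L' : FirstOrder.Language} [L.Structure A]
    [L'.Structure B] [∀ k, IsEmpty (L.Relations k)] {Q : Set B} {d : ℕ} {f : A → Fin d → B}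
    (hf : Function.Injective f) (hdom : Q.Definable L' (Set.range f))
    (hfun : ∀ (k : ℕ) (F : L.Functions k), Q.Definable L' {v : (Fin k × Fin d) ⊕ Fin d → B |
      ∃ a : Fin k → A, (∀ i j, v (Sum.inl (i, j)) = f (a i) j) ∧
        ∀ j, v (Sum.inr j) = f (FirstOrder.Language.Structure.funMap F a) j}) :
    (ofInjective f hf).IsInterpretation L L' Q where
  dom_definable := hdom
  eq_definable := by
    have h : Q.Definable L' {v : Fin d ⊕ Fin d → B | (fun j => v (Sum.inl j)) ∈ Set.range f ∧
        ∀ j, v (Sum.inl j) = v (Sum.inr j)} :=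
      Set.Definable.and (hdom.preimage_comp Sum.inl)
        (Set.Definable.forall_finite fun j =>
          (Set.DefinableFun.var _).ofPred_eq (Set.DefinableFun.var _))
    convert h using 3 with v
    simp only [coord_ofInjective_eq_iff, mem_dom_ofInjective]
    constructor
    · rintro ⟨hx, ⟨b, hb⟩, h⟩
      have hb' : (ofInjective f hf).coord ⟨fun j => v (Sum.inr j), ⟨b, hb⟩⟩ = b :=
        (coord_ofInjective_eq_iff _ _).2 hb.symm
      rw [hb', hb] at h
      exact ⟨hx, congrFun h⟩
    · rintro ⟨⟨a, ha⟩, h⟩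
      have h' : (fun j => v (Sum.inl j)) = fun j => v (Sum.inr j) := funext h
      refine ⟨⟨a, ha⟩, ⟨a, ha.trans h'⟩, ?_⟩
      have hb' : (ofInjective f hf).coord ⟨fun j => v (Sum.inr j), ⟨a, ha.trans h'⟩⟩ = a :=
        (coord_ofInjective_eq_iff _ _).2 (ha.trans h').symm
      rw [hb', ha]
  fun_definable k F := by
    convert hfun k F using 3 with v
    constructor
    · rintro ⟨hx, hy, h⟩
      refine ⟨fun i => (ofInjective f hf).coord ⟨_, hx i⟩, fun i => ?_, ?_⟩
      · exact congrFun ((coord_ofInjective_eq_iff ⟨_, hx i⟩ _).1 rfl)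
      · exact congrFun ((coord_ofInjective_eq_iff ⟨_, hy⟩ _).1 h.symm)
    · rintro ⟨a, ha, h⟩
      refine ⟨fun i => ⟨a i, (funext (ha i)).symm⟩, ⟨_, (funext h).symm⟩, ?_⟩
      rw [eq_comm, coord_ofInjective_eq_iff]
      refine (funext h).trans (congrArg _ (congrArg _ (funext fun i => ?_)))
      rw [eq_comm, coord_ofInjective_eq_iff]
      exact funext (ha i)
  rel_definable k r := isEmptyElim r

/-- The structure on the copy is transported along `copyEquiv`, so its inverse is automatically an
isomorphism; only the definability of its graph is in question. -/
theorem hasDefinableIso_of_definable {L : FirstOrder.Language} [L.Structure A] {P : Set A}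
    (f : CoordMap ι A A) (h : P.Definable L {v : Option ι → A |
      ∃ h : (fun i => v (some i)) ∈ f.dom, f.coord ⟨_, h⟩ = v none}) :
    f.HasDefinableIso L P := by
  refine ⟨f.copyEquiv.symm.inducedStructureEquiv, ?_⟩
  convert h using 5 with v hv
  rw [Equiv.toFun_inducedStructureEquiv, Equiv.symm_apply_eq, eq_comm]
  rfl

/-- For injective coordinates the graph of the isomorphism is the graph of the composite `a ↦ g (f
a)`, one coordinate at a time. -/
theorem hasDefinableIso_comp_ofInjective {L : FirstOrder.Language} [L.Structure A] {P : Set A}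
    {f : A → ι → B} (hf : Function.Injective f) {g : B → κ → A} (hg : Function.Injective g)
    (h : P.Definable L {v : Option (ι × κ) → A |
      ∀ i j, v (some (i, j)) = g (f (v none) i) j}) :
    ((ofInjective f hf).comp (ofInjective g hg)).HasDefinableIso L P := by
  apply hasDefinableIso_of_definable
  convert h using 3 with v
  simp only [comp, coord_ofInjective_eq_iff]
  constructor
  · rintro ⟨⟨h₁, h₂⟩, h⟩ i j
    have := (coord_ofInjective_eq_iff _ _).1 (congrFun h i)
    exact congrFun this j
  · intro h
    have h₁ : ∀ i, (fun j => v (some (i, j))) = g (f (v none) i) := fun i => funext (h i)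
    have h₂ : ∀ i (hi : (fun j => v (some (i, j))) ∈ (ofInjective g hg).dom),
        (ofInjective g hg).coord ⟨fun j => v (some (i, j)), hi⟩ = f (v none) i :=
      fun i hi => (coord_ofInjective_eq_iff _ _).2 (h₁ i)
    refine ⟨⟨fun i => ⟨_, (h₁ i).symm⟩, v none, ?_⟩, ?_⟩
    · funext i
      exact (h₂ i _).symm
    · funext i
      exact h₂ i _

end CoordMap

namespace upperTriangularGroup

open scoped Pointwise commutatorElement

variable {n : ℕ} {R : Type*} [CommRing R]

/-! ## Matrices of elements of the upper triangular group -/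

/-- The matrix of an element of `T_n(R)`. -/
def toMatrix (g : upperTriangularGroup n R) : Matrix (Fin n) (Fin n) R :=
  ((g : GL (Fin n) R) : Matrix (Fin n) (Fin n) R)

theorem toMatrix_injective : Function.Injective (toMatrix : upperTriangularGroup n R → _) :=
  fun _ _ h => Subtype.ext (Units.ext h)

@[simp] theorem toMatrix_one : toMatrix (1 : upperTriangularGroup n R) = 1 := rfl

@[simp] theorem toMatrix_mul (g h : upperTriangularGroup n R) :
    toMatrix (g * h) = toMatrix g * toMatrix h := rfl

@[simp] theorem toMatrix_transvection {k l : Fin n} (hkl : k < l) (b : R) :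
    toMatrix (transvection hkl b) = Matrix.transvection k l b := rfl

@[simp] theorem toMatrix_dilation (k : Fin n) (a : Rˣ) :
    toMatrix (dilation k a) = Matrix.diagonal (Function.update 1 k (a : R)) := rfl

theorem toMatrix_eq_zero (g : upperTriangularGroup n R) {i j : Fin n} (h : j < i) :
    toMatrix g i j = 0 :=
  g.2 h

theorem toMatrix_inv_mul (g : upperTriangularGroup n R) : toMatrix g⁻¹ * toMatrix g = 1 := by
  rw [← toMatrix_mul, inv_mul_cancel, toMatrix_one]

theorem isUnit_toMatrix_diag (g : upperTriangularGroup n R) (i : Fin n) :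
    IsUnit (toMatrix g i i) := by
  have h : IsUnit (toMatrix g).det :=
    (Matrix.isUnit_iff_isUnit_det _).1 (g : GL (Fin n) R).isUnit
  rw [Matrix.det_of_isUpperTriangular (M := toMatrix g) g.2, IsUnit.prod_univ_iff] at h
  exact h i

/-- An upper triangular matrix with invertible diagonal entries as an element of `T_n(R)`. -/
noncomputable def ofMatrix (M : Matrix (Fin n) (Fin n) R) (hM : M.IsUpperTriangular)
    (hd : ∀ i, IsUnit (M i i)) : upperTriangularGroup n R :=
  ⟨((Matrix.isUnit_iff_isUnit_det M).2 (by
    rw [Matrix.det_of_isUpperTriangular hM]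
    exact IsUnit.prod_univ_iff.2 hd)).unit, hM⟩

@[simp] theorem toMatrix_ofMatrix (M : Matrix (Fin n) (Fin n) R) (hM : M.IsUpperTriangular)
    (hd : ∀ i, IsUnit (M i i)) : toMatrix (ofMatrix M hM hd) = M := rfl

/-! ## Transvections and dilations -/

theorem transvection_injective {k l : Fin n} (hkl : k < l) :
    Function.Injective (transvection hkl : R → upperTriangularGroup n R) := by
  intro a b h
  have := congrFun (congrFun (congrArg toMatrix h) k) l
  simpa [Matrix.transvection] using this

theorem transvection_add {k l : Fin n} (hkl : k < l) (a b : R) :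
    transvection hkl (a + b) = transvection hkl a * transvection hkl b :=
  toMatrix_injective (Matrix.transvection_mul_transvection_same k l hkl.ne a b).symm

/-- The one-parameter group of transvections `t_{kl}(a)`. -/
def transvectionHom {k l : Fin n} (hkl : k < l) : Multiplicative R →* upperTriangularGroup n R :=
  MonoidHom.mk' (fun a => transvection hkl a.toAdd) fun _ _ => transvection_add hkl _ _

theorem transvection_zero {k l : Fin n} (hkl : k < l) :
    transvection hkl (0 : R) = 1 :=
  map_one (transvectionHom hkl)

theorem transvection_neg {k l : Fin n} (hkl : k < l) (a : R) :
    transvection hkl (-a) = (transvection hkl a)⁻¹ :=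
  map_inv (transvectionHom hkl) (Multiplicative.ofAdd a)

theorem transvection_zsmul {k l : Fin n} (hkl : k < l) (z : ℤ) (a : R) :
    transvection hkl (z • a) = transvection hkl a ^ z :=
  map_zpow (transvectionHom hkl) (Multiplicative.ofAdd a) z

/-- The ordered list product is forced by the noncommutativity of the ambient group, although these
transvections commute with one another. -/
theorem transvection_sum_ofFn {k l : Fin n} (hkl : k < l) {m : ℕ} (f : Fin m → R) :
    transvection hkl (∑ i, f i) = (List.ofFn fun i => transvection hkl (f i)).prod := by
  have := map_list_prod (transvectionHom hkl) (List.ofFn fun i => Multiplicative.ofAdd (f i))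
  rw [List.map_ofFn, List.prod_ofFn] at this
  rw [← List.sum_ofFn]
  rw [← List.prod_ofFn] at this
  exact this

theorem commutator_transvection {i j k : Fin n} (hij : i < j) (hjk : j < k) (a b : R) :
    ⁅transvection hij a, transvection hjk b⁆ = transvection (hij.trans hjk) (a * b) := by
  rw [commutatorElement_def, mul_inv_eq_iff_eq_mul, mul_inv_eq_iff_eq_mul]
  apply toMatrix_injective
  have h₁ : k ≠ j := hjk.ne'
  have h₂ : k ≠ i := (hij.trans hjk).ne'
  simp [Matrix.transvection, add_mul, mul_add, h₁, h₂]
  abel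

theorem dilation_mul (k : Fin n) (a b : Rˣ) :
    dilation k (a * b) = dilation k a * dilation k b := by
  apply toMatrix_injective
  simp only [toMatrix_dilation, toMatrix_mul, Matrix.diagonal_mul_diagonal]
  congr 1
  ext i
  by_cases h : i = k
  · subst h; simp
  · simp [h]

/-- The one-parameter group of dilations `d_k(a)`. -/
def dilationHom (k : Fin n) : Rˣ →* upperTriangularGroup n R :=
  MonoidHom.mk' (dilation k) (dilation_mul k)

/-- The commutator of `d_k(-1)` with an element commuting with all the other `d_i(-1)`, except
possibly `d_l(-1)`. -/
theorem exists_commutator_dilation_eq [IsDomain R] (h2 : (2 : R) ≠ 0) {k l : Fin n} (hkl : k < l)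
    (h : upperTriangularGroup n R)
    (hh : ∀ i, i ≠ k → i ≠ l → h * dilation i (-1 : Rˣ) = dilation i (-1 : Rˣ) * h) :
    ∃ a, ⁅dilation k (-1 : Rˣ), h⁆ = transvection hkl (2 * a) := by
  obtain ⟨u, hu⟩ := isUnit_toMatrix_diag h l
  -- In rows and columns `k, l`, with `h = (p, b; 0, u)`, conjugation by `d_k(-1)` changes `b` to
  -- `-b`, and multiplying by `h⁻¹` leaves `-2 b u⁻¹` in the `(k,l)` place.
  refine ⟨-(toMatrix h k l * (u⁻¹ : Rˣ)), ?_⟩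
  have hneg : ∀ x : R, -x = x → x = 0 := fun x hx => by
    have : 2 * x = 0 := by linear_combination -hx
    exact (mul_eq_zero.1 this).resolve_left h2
  have h0 : ∀ i j, i ≠ j → ¬ (i = k ∧ j = l) → toMatrix h i j = 0 := by
    intro i j hij hkl'
    -- Above the diagonal, a place other than `(k,l)` has an index outside `{k, l}`. Commuting with
    -- the corresponding dilation by `-1` makes the entry equal to its own negative, hence zero.
    rcases hij.lt_or_gt with hlt | hlt
    · by_cases hi : i = k ∨ i = l
      · have hj : j ≠ k ∧ j ≠ l := by
          rcases hi with rfl | rfl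
          · exact ⟨hij.symm, fun e => hkl' ⟨rfl, e⟩⟩
          · exact ⟨(hkl.trans hlt).ne', hij.symm⟩
        have := congrFun (congrFun (congrArg toMatrix (hh j hj.1 hj.2)) i) j
        simp [Matrix.mul_diagonal, Matrix.diagonal_mul, hij] at this
        exact hneg _ this
      · push Not at hi
        have := congrFun (congrFun (congrArg toMatrix (hh i hi.1 hi.2)) i) j
        simp [Matrix.mul_diagonal, Matrix.diagonal_mul, hij.symm] at this
        exact hneg _ this.symm
    · exact toMatrix_eq_zero h hlt
  rw [commutatorElement_def, mul_inv_eq_iff_eq_mul, mul_inv_eq_iff_eq_mul]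
  apply toMatrix_injective
  ext i j
  simp only [toMatrix_mul, toMatrix_dilation, toMatrix_transvection, Matrix.diagonal_mul,
    Matrix.mul_diagonal]
  by_cases hi : i = k
  · subst hi
    rw [Matrix.transvection_mul_apply_same]
    by_cases hj : j = i
    · subst hj
      simp [h0 l j hkl.ne' (fun e => hkl.ne' e.1)]
    · by_cases hjl : j = l
      · subst hjl
        simp [hj, ← hu]
        linear_combination (2 * toMatrix h i j) * u.inv_mul
      · simp [hj, h0 i j (Ne.symm hj) (fun e => hjl e.2),
          h0 l j (Ne.symm hjl) (fun e => hkl.ne' e.1)]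
  · rw [Matrix.transvection_mul_apply_of_ne _ _ _ _ hi]
    by_cases hij : i = j
    · subst hij; simp [hi]
    · simp [h0 i j hij (fun e => hi e.1)]

theorem commutator_dilation_transvection {k l : Fin n} (hkl : k < l) (a : R) :
    ⁅dilation k (-1 : Rˣ), transvection hkl a⁆ = transvection hkl (2 * -a) := by
  rw [commutatorElement_def, mul_inv_eq_iff_eq_mul, mul_inv_eq_iff_eq_mul, mul_assoc,
    ← toMatrix_injective.eq_iff]
  ext i j
  simp only [toMatrix_mul, toMatrix_dilation, toMatrix_transvection, Matrix.diagonal_mul,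
    ← mul_assoc, Matrix.mul_diagonal]
  by_cases hi : i = k
  · subst hi
    by_cases hj : j = i
    · subst hj
      simp [Matrix.transvection, hkl.ne', add_mul, mul_add]
    · by_cases hjl : j = l
      · subst hjl
        simp [Matrix.transvection, hj, hkl.ne, add_mul, mul_add]
        ring
      · simp [Matrix.transvection, hj, Ne.symm hj, Ne.symm hjl, add_mul, mul_add]
  · by_cases hij : i = j
    · subst hij
      simp [Matrix.transvection, hi, Ne.symm hi, add_mul, mul_add]
    · simp [Matrix.transvection, hi, Ne.symm hi, hij, add_mul, mul_add]

theorem transvection_mul_dilation {k l i : Fin n} (hkl : k < l) (hk : i ≠ k) (hl : i ≠ l) (a : R)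
    (u : Rˣ) : transvection hkl a * dilation i u = dilation i u * transvection hkl a := by
  apply toMatrix_injective
  ext x y
  simp only [toMatrix_mul, toMatrix_dilation, toMatrix_transvection, Matrix.diagonal_mul,
    Matrix.mul_diagonal, Matrix.transvection, Matrix.add_apply, Matrix.one_apply,
    Matrix.single_apply, Function.update_apply, Pi.one_apply]
  split_ifs <;> simp_all

/-! ## Bounded generation -/

theorem dilation_one (k : Fin n) : dilation k (1 : Rˣ) = 1 := map_one (dilationHom k)

/-- `T_n(R)` is the product of finitely many sets, each of them the set of all the `t_{kl}(a)`, for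
some `k < l`, or the set of all the `d_k(a)`, for some `k`. -/
theorem univ_of_mul_closed [NeZero n] (P : Set (upperTriangularGroup n R) → Prop)
    (hmul : ∀ S S', P S → P S' → P (S * S'))
    (ht : ∀ (k l : Fin n) (hkl : k < l), P (Set.range (transvection hkl)))
    (hd : ∀ k : Fin n, P (Set.range (dilation k))) : P Set.univ := by
  -- `P` is not assumed to pass to subsets, so the argument keeps track of supersets having `P`. At
  -- the end nothing is lost, because the only superset of the whole group is the group itself.
  have key : ∀ S S' S'' : Set (upperTriangularGroup n R), S ⊆ S' * S'' →
      (∃ T, S' ⊆ T ∧ P T) → (∃ T, S'' ⊆ T ∧ P T) → ∃ T, S ⊆ T ∧ P T := by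
    rintro S S' S'' h ⟨T, hT, hPT⟩ ⟨T', hT', hPT'⟩
    exact ⟨T * T', h.trans (Set.mul_subset_mul hT hT'), hmul _ _ hPT hPT'⟩
  -- Matrices differing from `1` only in column `j`, and there only on the diagonal and in the rows
  -- before `i`. Induction on `i` removes one off-diagonal entry at a time by a transvection, until
  -- a dilation remains.
  have col : ∀ (j : Fin n) (i : ℕ), i ≤ j → ∃ T, {g : upperTriangularGroup n R |
      ∀ a b, (b ≠ j ∨ (i ≤ a.val ∧ a ≠ j)) →
        toMatrix g a b = (1 : Matrix (Fin n) (Fin n) R) a b} ⊆ T ∧ P T := by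
    intro j i
    induction i with
    | zero =>
      intro _
      refine ⟨_, ?_, hd j⟩
      intro g hg
      obtain ⟨u, hu⟩ := isUnit_toMatrix_diag g j
      refine ⟨u, toMatrix_injective ?_⟩
      ext a b
      rw [toMatrix_dilation, Matrix.diagonal_apply]
      by_cases hb : b = j
      · subst hb
        by_cases ha : a = b
        · subst ha; simp [hu]
        · rw [hg a b (Or.inr ⟨Nat.zero_le _, ha⟩)]; simp [ha]
      · rw [hg a b (Or.inl hb), Matrix.one_apply]
        split_ifs with h
        · subst h; simp [hb]
        · rfl
    | succ i ih =>
      intro hi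
      have hlt : (⟨i, by omega⟩ : Fin n) < j := by rw [Fin.lt_def]; simpa using hi
      set i' : Fin n := ⟨i, by omega⟩ with hi'
      refine key _ _ _ ?_ ⟨_, subset_rfl, ht i' j hlt⟩ (ih (by omega))
      intro g hg
      obtain ⟨u, hu⟩ := isUnit_toMatrix_diag g j
      -- The `(j,j)` entry is `u`, so left multiplication by `t_{i'j}(-c)` subtracts `c u` from the
      -- `(i',j)` entry; this choice of `c` makes that entry vanish.
      set c := toMatrix g i' j * (u⁻¹ : Rˣ) with hc
      refine Set.mem_mul.2 ⟨transvection hlt c, ⟨c, rfl⟩, transvection hlt (-c) * g, ?_, ?_⟩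
      · intro a b hab
        rw [toMatrix_mul, toMatrix_transvection]
        by_cases ha : a = i'
        · subst ha
          rw [Matrix.transvection_mul_apply_same]
          by_cases hb : b = j
          · subst hb
            simp [← hu, hc, hlt.ne]
          · rw [hg _ b (Or.inl hb), hg j b (Or.inl hb), Matrix.one_apply_ne (Ne.symm hb)]
            simp
        · rw [Matrix.transvection_mul_apply_of_ne _ _ _ _ ha]
          refine hg a b (hab.imp_right fun h => ⟨?_, h.2⟩)
          have : a.val ≠ i := fun e => ha (Fin.ext e)
          omega
      · rw [transvection_neg, mul_inv_cancel_left]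
  -- Matrices that agree with `1` from column `j` onwards. The last nontrivial column is split off
  -- on the left as a matrix of the kind treated in `col`.
  have cols : ∀ j : ℕ, j ≤ n → ∃ T, {g : upperTriangularGroup n R |
      ∀ a b : Fin n, j ≤ b.val →
        toMatrix g a b = (1 : Matrix (Fin n) (Fin n) R) a b} ⊆ T ∧ P T := by
    intro j
    induction j with
    | zero =>
      intro _
      -- Only the identity is left, and any of the generating sets contains it; index `0` exists
      -- because `n ≠ 0`.
      refine ⟨_, ?_, hd 0⟩
      intro g hg
      refine ⟨1, ?_⟩
      rw [dilation_one]
      apply toMatrix_injective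
      ext a b
      rw [hg a b (Nat.zero_le _), toMatrix_one]
    | succ j ih =>
      intro hj
      set j' : Fin n := ⟨j, by omega⟩ with hj'
      refine key _ _ _ ?_ (col j' j le_rfl) (ih (by omega))
      intro g hg
      have hM : ((1 : Matrix (Fin n) (Fin n) R).updateCol j'
          fun a => toMatrix g a j').IsUpperTriangular := by
        intro a b hab
        have hab' : b < a := hab
        by_cases hb : b = j'
        · subst hb; simpa using toMatrix_eq_zero g hab'
        · simp [Matrix.updateCol_ne hb, hab'.ne']
      have hu : ∀ i, IsUnit (((1 : Matrix (Fin n) (Fin n) R).updateCol j'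
          fun a => toMatrix g a j') i i) := by
        intro i
        by_cases hi : i = j'
        · subst hi; simpa using isUnit_toMatrix_diag g _
        · simp [Matrix.updateCol_ne hi]
      refine Set.mem_mul.2 ⟨ofMatrix _ hM hu, ?_, (ofMatrix _ hM hu)⁻¹ * g, ?_, by group⟩
      · rintro a b hab
        rw [toMatrix_ofMatrix]
        by_cases hb : b = j'
        · subst hb
          obtain ⟨h₁, h₂⟩ := hab.resolve_left (fun h => h rfl)
          have : j' < a := lt_of_le_of_ne h₁ (Ne.symm h₂)
          rw [Matrix.updateCol_self, toMatrix_eq_zero g this, Matrix.one_apply_ne h₂]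
        · rw [Matrix.updateCol_ne hb]
      · intro a b hb
        -- From column `j` onwards `g` and the split-off factor `C` have the same columns, so `C⁻¹
        -- g` and `C⁻¹ C = 1` agree there.
        refine Eq.trans ?_ (congrFun (congrFun (toMatrix_inv_mul (ofMatrix _ hM hu)) a) b)
        rw [toMatrix_mul, Matrix.mul_apply, Matrix.mul_apply]
        refine Finset.sum_congr rfl fun x _ => congrArg _ ?_
        rw [toMatrix_ofMatrix]
        by_cases hbj : b = j'
        · subst hbj; simp
        · rw [Matrix.updateCol_ne hbj]
          refine hg x b ?_
          have : b.val ≠ j := fun e => hbj (Fin.ext e)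
          omega
  obtain ⟨T, hT, hPT⟩ := cols n le_rfl
  rwa [Set.eq_univ_of_forall fun g => hT fun a b hb => absurd b.2 (by omega)] at hPT

/-- Being contained in the subgroup generated by the parameters is preserved by products of sets, so
it suffices to check each one-parameter set of transvections or dilations. -/
theorem closure_params_eq_top [NeZero n] {r m : ℕ} {α : Fin r → Rˣ}
    (hα : Subgroup.closure (Set.range α) = ⊤) {β : Fin m → R}
    (hβ : Submodule.span ℤ (Set.range β) = ⊤) :
    Subgroup.closure (params n β α) = ⊤ := by
  refine (Subgroup.eq_top_iff' _).2 fun g => ?_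
  refine univ_of_mul_closed (fun S => ∀ g ∈ S, g ∈ Subgroup.closure (params n β α))
    ?_ ?_ ?_ g trivial
  · rintro S S' hS hS' _ ⟨x, hx, y, hy, rfl⟩
    exact mul_mem (hS x hx) (hS' y hy)
  · rintro k l hkl _ ⟨b, rfl⟩
    have hb : b ∈ Submodule.span ℤ (Set.range β) := by rw [hβ]; trivial
    induction hb using Submodule.span_induction with
    | mem x hx =>
      obtain ⟨i, rfl⟩ := hx
      exact Subgroup.subset_closure (Or.inl ⟨k, l, hkl, i, rfl⟩)
    | zero => rw [transvection_zero]; exact one_mem _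
    | add x y _ _ hx hy => rw [transvection_add]; exact mul_mem hx hy
    | smul z x _ hx => rw [transvection_zsmul]; exact zpow_mem hx z
  · rintro k _ ⟨u, rfl⟩
    have h : Subgroup.closure (Set.range α) ≤
        (Subgroup.closure (params n β α)).comap (dilationHom k) := by
      rw [Subgroup.closure_le]
      rintro _ ⟨j, rfl⟩
      exact Subgroup.subset_closure (Or.inr ⟨k, j, rfl⟩)
    exact h (by rw [hα]; trivial)

end upperTriangularGroup

namespace upperTriangularGroup

open scoped Pointwise commutatorElement

variable {N : ℕ} {R : Type*} [CommRing R] {Q : Set (upperTriangularGroup (N + 3) R)}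

/-! ## Definability in the upper triangular group -/

/-- Commutators with `d_k(-1)` give exactly `t_{kl}(2R)`; the remaining cosets are reached by a
finite disjunction over representatives of `R/2R`, used as constants. -/
theorem definable_mem_range_transvection [IsDomain R] (h2 : (2 : R) ≠ 0)
    [Finite (R ⧸ Ideal.span {(2 : R)})] (hQ : Subgroup.closure Q = ⊤) {k l : Fin (N + 3)}
    (hkl : k < l) {ι : Type*} {F : (ι → upperTriangularGroup (N + 3) R) → _}
    (hF : Q.DefinableFun groupLanguage F) :
    Q.Definable groupLanguage {v | ∃ a, F v = transvection hkl a} := by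
  have hiff : ∀ g : upperTriangularGroup (N + 3) R, (∃ a, g = transvection hkl a) ↔
      ∃ h, (∀ i, i ≠ k → i ≠ l → h * dilation i (-1 : Rˣ) = dilation i (-1 : Rˣ) * h) ∧
        ∃ c : R ⧸ Ideal.span {(2 : R)},
          g = transvection hkl c.out * ⁅dilation k (-1 : Rˣ), h⁆ := by
    intro g
    constructor
    · rintro ⟨a, rfl⟩
      have h : a - (Ideal.Quotient.mk (Ideal.span {(2 : R)}) a).out ∈ Ideal.span {(2 : R)} := by
        rw [← Ideal.Quotient.eq]
        exact (Quotient.out_eq _).symm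
      obtain ⟨b, hb⟩ := Ideal.mem_span_singleton'.1 h
      -- Here `a = c + 2b` with `c` the chosen representative of the class of `a`, and `[d_k(-1),
      -- t_{kl}(-b)] = t_{kl}(2b)`.
      refine ⟨transvection hkl (-b), fun i hi hi' => transvection_mul_dilation hkl hi hi' _ _,
        Ideal.Quotient.mk _ a, ?_⟩
      rw [commutator_dilation_transvection, ← transvection_add]
      congr 1
      linear_combination -hb
    · rintro ⟨h, hh, c, rfl⟩
      obtain ⟨a, ha⟩ := exists_commutator_dilation_eq h2 hkl h hh
      exact ⟨c.out + 2 * a, by rw [ha, transvection_add]⟩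
  have key : Q.Definable groupLanguage
      {v : Unit → upperTriangularGroup (N + 3) R | ∃ a, v () = transvection hkl a} := by
    simp only [hiff]
    refine Set.Definable.exists_elem (Set.Definable.and ?_ ?_)
    · refine Set.Definable.forall_finite fun i => Set.Definable.imp_const _ fun _ =>
        Set.Definable.imp_const _ fun _ => ?_
      exact ((Set.DefinableFun.var _).group_mul (.group_const hQ _)).ofPred_eq
        (Set.DefinableFun.group_mul (.group_const hQ _) (.var _))
    · refine Set.Definable.exists_finite fun c => ?_
      exact (Set.DefinableFun.var _).ofPred_eq (Set.DefinableFun.group_mul (.group_const hQ _)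
        (.group_commutator (.group_const hQ _) (.var _)))
  exact key.subst (F := fun _ => F) fun _ => hF

/-! ### The ring on the upper right corner, and the definability of matrix entries -/

theorem zero_lt_last : (0 : Fin (N + 3)) < Fin.last (N + 2) := Fin.last_pos

theorem zero_lt_one : (0 : Fin (N + 3)) < 1 := Fin.zero_lt_one

theorem one_lt_last : (1 : Fin (N + 3)) < Fin.last (N + 2) := by
  rw [Fin.lt_def]; simp

/-- The transvection with `a` in the upper right corner. -/
def corner (a : R) : upperTriangularGroup (N + 3) R :=
  transvection (zero_lt_last (N := N)) a

theorem corner_injective : Function.Injective (corner : R → upperTriangularGroup (N + 3) R) :=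
  transvection_injective zero_lt_last

theorem commutator_corner (a b : R) :
    ⁅transvection (zero_lt_one (N := N)) a, transvection (one_lt_last (N := N)) b⁆ =
      corner (a * b) :=
  commutator_transvection _ _ a b

/-- Multiplication of the ring is definable on the upper right corner. -/
theorem definable_corner_mul [IsDomain R] (h2 : (2 : R) ≠ 0)
    [Finite (R ⧸ Ideal.span {(2 : R)})] (hQ : Subgroup.closure Q = ⊤)
    {ι : Type*} {F H J : (ι → upperTriangularGroup (N + 3) R) → _}
    (hF : Q.DefinableFun groupLanguage F) (hH : Q.DefinableFun groupLanguage H)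
    (hJ : Q.DefinableFun groupLanguage J) :
    Q.Definable groupLanguage
      {v | ∃ a b, F v = corner a ∧ H v = corner b ∧ J v = corner (a * b)} := by
  -- Two corner elements commute, so their factors are first moved to the adjacent places `(0,1)`
  -- and `(1,last)`. Commutators with the constants `t(1)` tie `p` and `q` to `x` and `y`, and `[p,
  -- q]` is the product.
  have hiff : ∀ x y z : upperTriangularGroup (N + 3) R,
      (∃ a b, x = corner a ∧ y = corner b ∧ z = corner (a * b)) ↔
      ∃ p : upperTriangularGroup (N + 3) R, (∃ a, p = transvection zero_lt_one a) ∧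
        ∃ q : upperTriangularGroup (N + 3) R, (∃ b, q = transvection one_lt_last b) ∧
        x = ⁅p, transvection (one_lt_last (N := N)) (1 : R)⁆ ∧
        y = ⁅transvection (zero_lt_one (N := N)) (1 : R), q⁆ ∧ z = ⁅p, q⁆ := by
    intro x y z
    constructor
    · rintro ⟨a, b, rfl, rfl, rfl⟩
      exact ⟨_, ⟨a, rfl⟩, _, ⟨b, rfl⟩, by simp [commutator_corner]⟩
    · rintro ⟨_, ⟨a, rfl⟩, _, ⟨b, rfl⟩, rfl, rfl, rfl⟩
      exact ⟨a, b, by simp [commutator_corner]⟩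
  have key : Q.Definable groupLanguage {v : Fin 3 → upperTriangularGroup (N + 3) R |
      ∃ a b, v 0 = corner a ∧ v 1 = corner b ∧ v 2 = corner (a * b)} := by
    simp only [hiff]
    refine Set.Definable.exists_elem (Set.Definable.and
      (definable_mem_range_transvection h2 hQ _ (.var _)) ?_)
    refine Set.Definable.exists_elem (P := fun (v : Option (Fin 3) → _) q =>
      (∃ b, q = transvection one_lt_last b) ∧
        v (some 0) = ⁅v none, transvection (one_lt_last (N := N)) (1 : R)⁆ ∧
        v (some 1) = ⁅transvection (zero_lt_one (N := N)) (1 : R), q⁆ ∧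
        v (some 2) = ⁅v none, q⁆) (Set.Definable.and
      (definable_mem_range_transvection h2 hQ _ (.var _)) ?_)
    refine Set.Definable.and ?_ (Set.Definable.and ?_ ?_)
    · exact (Set.DefinableFun.var _).ofPred_eq (.group_commutator (.var _) (.group_const hQ _))
    · exact (Set.DefinableFun.var _).ofPred_eq (.group_commutator (.group_const hQ _) (.var _))
    · exact (Set.DefinableFun.var _).ofPred_eq (.group_commutator (.var _) (.var _))
  exact key.subst (F := ![F, H, J]) (by simp [Fin.forall_fin_succ, hF, hH, hJ])

/-- A definable map carries `t_{kl}(a)` to the upper right corner. -/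
theorem exists_definable_transvection_to_corner (hQ : Subgroup.closure Q = ⊤)
    {k l : Fin (N + 3)} (hkl : k < l) :
    ∃ T : upperTriangularGroup (N + 3) R → upperTriangularGroup (N + 3) R,
      (∀ a, T (transvection hkl a) = corner a) ∧
      ∀ {ι : Type} {F : (ι → upperTriangularGroup (N + 3) R) → _},
        Q.DefinableFun groupLanguage F → Q.DefinableFun groupLanguage fun v => T (F v) := by
  -- The column index is moved from `l` to the last by a commutator with `t_{l,last}(1)` on the
  -- right, then the row index from `k` to `0` by one with `t_{0k}(1)` on the left. Either move is
  -- the identity when the index is already in place.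
  have hk : k < Fin.last (N + 2) := hkl.trans_le (Fin.le_last l)
  obtain ⟨T₁, hT₁, hd₁⟩ : ∃ T : upperTriangularGroup (N + 3) R → upperTriangularGroup (N + 3) R,
      (∀ a, T (transvection hkl a) = transvection hk a) ∧
      ∀ {ι : Type} {F : (ι → upperTriangularGroup (N + 3) R) → _},
        Q.DefinableFun groupLanguage F → Q.DefinableFun groupLanguage fun v => T (F v) := by
    rcases (Fin.le_last l).eq_or_lt with rfl | hl
    · exact ⟨id, fun _ => rfl, fun hF => hF⟩
    · exact ⟨fun g => ⁅g, transvection hl (1 : R)⁆, fun a => by simp [commutator_transvection],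
        fun hF => hF.group_commutator (.group_const hQ _)⟩
  obtain ⟨T₂, hT₂, hd₂⟩ : ∃ T : upperTriangularGroup (N + 3) R → upperTriangularGroup (N + 3) R,
      (∀ a, T (transvection hk a) = corner a) ∧
      ∀ {ι : Type} {F : (ι → upperTriangularGroup (N + 3) R) → _},
        Q.DefinableFun groupLanguage F → Q.DefinableFun groupLanguage fun v => T (F v) := by
    rcases (Fin.zero_le k).eq_or_lt with rfl | hl
    · exact ⟨id, fun _ => rfl, fun hF => hF⟩
    · exact ⟨fun g => ⁅transvection hl (1 : R), g⁆, fun a => by simp [commutator_transvection, corner],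
        fun hF => .group_commutator (.group_const hQ _) hF⟩
  exact ⟨fun g => T₂ (T₁ g), fun a => by simp only [hT₁, hT₂], fun hF => hd₂ (hd₁ hF)⟩

/-- The matrix entries of an element of `S`, placed in the upper right corner, are definable
from that element. -/
def EntriesDefinable (Q S : Set (upperTriangularGroup (N + 3) R)) : Prop :=
  Q.Definable groupLanguage
    {v : Option (Fin (N + 3) × Fin (N + 3)) → upperTriangularGroup (N + 3) R |
      v none ∈ S ∧ ∀ i j, v (some (i, j)) = corner (toMatrix (v none) i j)}

/-- Only the `(k,l)` entry varies, and it reaches the corner by a definable map; all the other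
entries are constants. -/
theorem entriesDefinable_range_transvection [IsDomain R] (h2 : (2 : R) ≠ 0)
    [Finite (R ⧸ Ideal.span {(2 : R)})] (hQ : Subgroup.closure Q = ⊤) {k l : Fin (N + 3)}
    (hkl : k < l) : EntriesDefinable Q (Set.range (transvection hkl)) := by
  obtain ⟨T, hT, hd⟩ := exists_definable_transvection_to_corner hQ hkl
  have h : Q.Definable groupLanguage
      {v : Option (Fin (N + 3) × Fin (N + 3)) → upperTriangularGroup (N + 3) R |
        (∃ a, v none = transvection hkl a) ∧ v (some (k, l)) = T (v none) ∧
        ∀ i j, ¬ (i = k ∧ j = l) →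
          v (some (i, j)) = corner ((1 : Matrix (Fin (N + 3)) (Fin (N + 3)) R) i j)} :=
    .and (definable_mem_range_transvection h2 hQ hkl (.var _))
      (.and ((Set.DefinableFun.var _).ofPred_eq (hd (.var _)))
        (.forall_finite fun i => .forall_finite fun j => .imp_const _ fun _ =>
          (Set.DefinableFun.var _).ofPred_eq (.group_const hQ _)))
  unfold EntriesDefinable
  convert h using 3 with v
  have hentry : ∀ (a : R) (i j : Fin (N + 3)), ¬ (i = k ∧ j = l) →
      Matrix.transvection k l a i j = (1 : Matrix (Fin (N + 3)) (Fin (N + 3)) R) i j := by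
    intro a i j hij
    have : ¬ (k = i ∧ l = j) := fun h => hij ⟨h.1.symm, h.2.symm⟩
    simp [Matrix.transvection, this]
  have hkl' : ∀ a : R, Matrix.transvection k l a k l = a := by
    intro a
    simp [Matrix.transvection, hkl.ne]
  constructor
  · rintro ⟨⟨a, ha⟩, h⟩
    rw [← ha] at h ⊢
    refine ⟨⟨a, rfl⟩, ?_, fun i j hij => ?_⟩
    · rw [h, hT, toMatrix_transvection, hkl']
    · rw [h, toMatrix_transvection, hentry a i j hij]
  · rintro ⟨⟨a, ha⟩, h, h'⟩
    rw [ha] at h ⊢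
    refine ⟨⟨a, rfl⟩, fun i j => ?_⟩
    by_cases hij : i = k ∧ j = l
    · obtain ⟨rfl, rfl⟩ := hij
      rw [h, hT, toMatrix_transvection, hkl']
    · rw [h' i j hij, toMatrix_transvection, hentry a i j hij]

/-- With finitely many units the set is finite, so the graph is a finite disjunction of conditions
on constants. -/
theorem entriesDefinable_range_dilation [Finite Rˣ] (hQ : Subgroup.closure Q = ⊤)
    (k : Fin (N + 3)) : EntriesDefinable Q (Set.range (dilation k)) := by
  have h : Q.Definable groupLanguage
      {v : Option (Fin (N + 3) × Fin (N + 3)) → upperTriangularGroup (N + 3) R |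
        ∃ u : Rˣ, v none = dilation k u ∧
          ∀ i j, v (some (i, j)) = corner (toMatrix (dilation k u) i j)} :=
    .exists_finite fun u => .and ((Set.DefinableFun.var _).ofPred_eq (.group_const hQ _))
      (.forall_finite fun i => .forall_finite fun j =>
        (Set.DefinableFun.var _).ofPred_eq (.group_const hQ _))
  unfold EntriesDefinable
  convert h using 3 with v
  constructor
  · rintro ⟨⟨u, hu⟩, h⟩
    exact ⟨u, hu.symm, by rwa [hu]⟩
  · rintro ⟨u, hu, h⟩
    exact ⟨⟨u, hu.symm⟩, by rwa [hu]⟩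

/-- The entries of `g g'` are sums of products of entries. In the corner both operations are
definable, and the factorization is existentially quantified: any choice of factors yields the same
entries. -/
theorem EntriesDefinable.mul [IsDomain R] (h2 : (2 : R) ≠ 0)
    [Finite (R ⧸ Ideal.span {(2 : R)})] (hQ : Subgroup.closure Q = ⊤)
    {S S' : Set (upperTriangularGroup (N + 3) R)} (hS : EntriesDefinable Q S)
    (hS' : EntriesDefinable Q S') : EntriesDefinable Q (S * S') := by
  let I := Option (Fin (N + 3) × Fin (N + 3))
  -- Quantified variables: the first factor with its entries, the second with its entries, and the
  -- products of the `(i,k)` and `(k,j)` entries, indexed by `(i,k,j)`.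
  let W := I ⊕ I ⊕ (Fin (N + 3) × Fin (N + 3) × Fin (N + 3))
  have h : Q.Definable groupLanguage {v : I → upperTriangularGroup (N + 3) R |
      ∃ w : W → upperTriangularGroup (N + 3) R,
        (w (.inl none) ∈ S ∧
          ∀ i j, w (.inl (some (i, j))) = corner (toMatrix (w (.inl none)) i j)) ∧
        (w (.inr (.inl none)) ∈ S' ∧
          ∀ i j, w (.inr (.inl (some (i, j)))) =
            corner (toMatrix (w (.inr (.inl none))) i j)) ∧
        (∀ i k j, ∃ a b, w (.inl (some (i, k))) = corner a ∧
          w (.inr (.inl (some (k, j)))) = corner b ∧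
          w (.inr (.inr (i, k, j))) = corner (a * b)) ∧
        v none = w (.inl none) * w (.inr (.inl none)) ∧
        ∀ i j, v (some (i, j)) =
          (List.ofFn fun k => w (.inr (.inr (i, k, j)))).prod} := by
    refine Set.Definable.exists_tuple (.and ?_ (.and ?_ (.and ?_ (.and ?_ ?_))))
    · exact Set.Definable.preimage_comp (fun o => Sum.inr (Sum.inl o)) hS
    · exact Set.Definable.preimage_comp (fun o => Sum.inr (Sum.inr (Sum.inl o))) hS'
    · exact .forall_finite fun i => .forall_finite fun k => .forall_finite fun j =>
        definable_corner_mul h2 hQ (.var _) (.var _) (.var _)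
    · exact (Set.DefinableFun.var _).ofPred_eq (.group_mul (.var _) (.var _))
    · exact .forall_finite fun i => .forall_finite fun j =>
        (Set.DefinableFun.var _).ofPred_eq (.group_prod_ofFn fun k => .var _)
  unfold EntriesDefinable
  convert h using 3 with v
  constructor
  · rintro ⟨⟨g, hg, g', hg', hgg⟩, h⟩
    have hgg : g * g' = v none := hgg
    rw [← hgg] at h ⊢
    refine ⟨Sum.elim (fun o => o.elim g fun p => corner (toMatrix g p.1 p.2))
      (Sum.elim (fun o => o.elim g' fun p => corner (toMatrix g' p.1 p.2))
        fun p => corner (toMatrix g p.1 p.2.1 * toMatrix g' p.2.1 p.2.2)),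
      ⟨hg, fun _ _ => rfl⟩, ⟨hg', fun _ _ => rfl⟩, fun i k j => ⟨_, _, rfl, rfl, rfl⟩, rfl,
      fun i j => ?_⟩
    rw [h, toMatrix_mul, Matrix.mul_apply]
    exact transvection_sum_ofFn _ _
  · rintro ⟨w, ⟨hg, h⟩, ⟨hg', h'⟩, hm, hv, hp⟩
    rw [hv]
    refine ⟨⟨_, hg, _, hg', rfl⟩, fun i j => ?_⟩
    rw [hp, toMatrix_mul, Matrix.mul_apply]
    refine Eq.trans ?_ (transvection_sum_ofFn _ _).symm
    congr 2
    funext k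
    obtain ⟨a, b, ha, hb, hab⟩ := hm i k j
    rw [h] at ha
    rw [h'] at hb
    rw [hab, ← corner_injective ha, ← corner_injective hb]
    rfl

theorem entriesDefinable_univ [IsDomain R] (h2 : (2 : R) ≠ 0)
    [Finite (R ⧸ Ideal.span {(2 : R)})] [Finite Rˣ] (hQ : Subgroup.closure Q = ⊤) :
    EntriesDefinable Q Set.univ :=
  univ_of_mul_closed (EntriesDefinable Q) (fun _ _ => EntriesDefinable.mul h2 hQ)
    (fun _ _ hkl => entriesDefinable_range_transvection h2 hQ hkl)
    (fun k => entriesDefinable_range_dilation hQ k)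

/-! ## The two interpretations -/

/-- The tuple representing a ring element in `T_n(R)`. -/
def ringCoord (a : R) : Fin 1 → upperTriangularGroup (N + 3) R := fun _ => corner a

theorem ringCoord_injective :
    Function.Injective (ringCoord : R → Fin 1 → upperTriangularGroup (N + 3) R) :=
  fun _ _ h => corner_injective (congrFun h 0)

/-- The tuple of all matrix entries. -/
def groupCoord {n : ℕ} (g : upperTriangularGroup n R) : Fin (n * n) → R :=
  fun e => toMatrix g (finProdFinEquiv.symm e).1 (finProdFinEquiv.symm e).2

theorem groupCoord_apply {n : ℕ} (g : upperTriangularGroup n R) (i j : Fin n) :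
    groupCoord g (finProdFinEquiv (i, j)) = toMatrix g i j := by
  simp only [groupCoord, Equiv.symm_apply_apply]

theorem groupCoord_injective {n : ℕ} :
    Function.Injective (groupCoord : upperTriangularGroup n R → Fin (n * n) → R) := by
  intro g h hgh
  apply toMatrix_injective
  ext i j
  rw [← groupCoord_apply, hgh, groupCoord_apply]

theorem forall_eq_groupCoord_iff {n : ℕ} (g : upperTriangularGroup n R) (x : Fin (n * n) → R) :
    (∀ e, x e = groupCoord g e) ↔ ∀ i j, x (finProdFinEquiv (i, j)) = toMatrix g i j := by
  rw [← finProdFinEquiv.forall_congr_right, Prod.forall]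
  simp only [groupCoord_apply]

variable [FirstOrder.Ring.CompatibleRing R]

theorem isInterpretation_ringCoord [IsDomain R] (h2 : (2 : R) ≠ 0)
    [Finite (R ⧸ Ideal.span {(2 : R)})] (hQ : Subgroup.closure Q = ⊤) :
    (CoordMap.ofInjective ringCoord
      (ringCoord_injective (N := N) (R := R))).IsInterpretation
      FirstOrder.Language.ring groupLanguage Q := by
  have : ∀ k, IsEmpty (FirstOrder.Language.ring.Relations k) := fun k => ⟨fun r => r.elim⟩
  have hT : ∀ {ι : Type} (i : ι), Q.Definable groupLanguage
      {v : ι → upperTriangularGroup (N + 3) R | ∃ a, v i = corner a} := fun i =>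
    definable_mem_range_transvection h2 hQ _ (.var i)
  refine CoordMap.isInterpretation_ofInjective _ ?_ ?_
  · convert hT (0 : Fin 1) using 1
    ext v
    simp only [ringCoord, Set.mem_range, funext_iff, Fin.forall_fin_one, Set.mem_ofPred_eq,
      eq_comm]
  · intro k F
    simp only [ringCoord, Fin.forall_fin_one]
    cases F with
    | add =>
      have h : Q.Definable groupLanguage
          {v : (Fin 2 × Fin 1) ⊕ Fin 1 → upperTriangularGroup (N + 3) R |
            (∃ a, v (.inl (0, 0)) = corner a) ∧ (∃ a, v (.inl (1, 0)) = corner a) ∧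
            v (.inr 0) = v (.inl (0, 0)) * v (.inl (1, 0))} :=
        .and (hT _) (.and (hT _) ((Set.DefinableFun.var _).ofPred_eq
          (.group_mul (.var _) (.var _))))
      convert h using 3 with v
      constructor
      · rintro ⟨a, ha, h⟩
        refine ⟨⟨_, ha 0⟩, ⟨_, ha 1⟩, ?_⟩
        rw [h, ha 0, ha 1]
        exact (congrArg corner (FirstOrder.Ring.CompatibleRing.funMap_add a)).trans
          (transvection_add _ _ _)
      · rintro ⟨⟨a, ha⟩, ⟨b, hb⟩, h⟩
        refine ⟨![a, b], by simp [Fin.forall_fin_two, ha, hb], ?_⟩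
        rw [h, ha, hb]
        exact ((congrArg corner (FirstOrder.Ring.CompatibleRing.funMap_add ![a, b])).trans
          (transvection_add _ _ _)).symm
    | mul =>
      have h : Q.Definable groupLanguage
          {v : (Fin 2 × Fin 1) ⊕ Fin 1 → upperTriangularGroup (N + 3) R |
            ∃ a b, v (.inl (0, 0)) = corner a ∧ v (.inl (1, 0)) = corner b ∧
            v (.inr 0) = corner (a * b)} :=
        definable_corner_mul h2 hQ (.var _) (.var _) (.var _)
      convert h using 3 with v
      constructor
      · rintro ⟨a, ha, h⟩
        exact ⟨a 0, a 1, ha 0, ha 1,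
          h.trans (congrArg corner (FirstOrder.Ring.CompatibleRing.funMap_mul a))⟩
      · rintro ⟨a, b, ha, hb, h⟩
        exact ⟨![a, b], by simp [Fin.forall_fin_two, ha, hb],
          h.trans (congrArg corner (FirstOrder.Ring.CompatibleRing.funMap_mul ![a, b])).symm⟩
    | neg =>
      have h : Q.Definable groupLanguage
          {v : (Fin 1 × Fin 1) ⊕ Fin 1 → upperTriangularGroup (N + 3) R |
            (∃ a, v (.inl (0, 0)) = corner a) ∧ v (.inr 0) = (v (.inl (0, 0)))⁻¹} :=
        .and (hT _) ((Set.DefinableFun.var _).ofPred_eq (.group_inv (.var _)))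
      convert h using 3 with v
      constructor
      · rintro ⟨a, ha, h⟩
        refine ⟨⟨_, ha 0⟩, ?_⟩
        rw [h, ha 0]
        exact (congrArg corner (FirstOrder.Ring.CompatibleRing.funMap_neg a)).trans
          (transvection_neg _ _)
      · rintro ⟨⟨a, ha⟩, h⟩
        refine ⟨![a], by simp [ha], ?_⟩
        rw [h, ha]
        exact ((congrArg corner (FirstOrder.Ring.CompatibleRing.funMap_neg ![a])).trans
          (transvection_neg _ _)).symm
    | zero =>
      have h : Q.Definable groupLanguage
          {v : (Fin 0 × Fin 1) ⊕ Fin 1 → upperTriangularGroup (N + 3) R |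
            v (.inr 0) = corner 0} :=
        (Set.DefinableFun.var _).ofPred_eq (.group_const hQ _)
      convert h using 3 with v
      have h0 := fun a : Fin 0 → R => FirstOrder.Ring.CompatibleRing.funMap_zero a
      exact ⟨fun ⟨a, _, h⟩ => h.trans (congrArg corner (h0 a)),
        fun h => ⟨![], fun i => i.elim0, h.trans (congrArg corner (h0 _)).symm⟩⟩
    | one =>
      have h : Q.Definable groupLanguage
          {v : (Fin 0 × Fin 1) ⊕ Fin 1 → upperTriangularGroup (N + 3) R |
            v (.inr 0) = corner 1} :=
        (Set.DefinableFun.var _).ofPred_eq (.group_const hQ _)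
      convert h using 3 with v
      have h1 := fun a : Fin 0 → R => FirstOrder.Ring.CompatibleRing.funMap_one a
      exact ⟨fun ⟨a, _, h⟩ => h.trans (congrArg corner (h1 a)),
        fun h => ⟨![], fun i => i.elim0, h.trans (congrArg corner (h1 _)).symm⟩⟩

/-- The tuples that consist of the entries of an element of `T_n(R)` are definable in the ring. -/
theorem definable_exists_toMatrix {n : ℕ} {P : Set R} {ι : Type*} (x : Fin n → Fin n → ι) :
    P.Definable FirstOrder.Language.ring
      {v : ι → R | ∃ g : upperTriangularGroup n R, ∀ i j, v (x i j) = toMatrix g i j} := by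
  -- An upper triangular matrix is invertible exactly when its diagonal entries are units.
  have h : P.Definable FirstOrder.Language.ring {v : ι → R |
      (∀ i j, j < i → v (x i j) = 0) ∧ ∀ i, ∃ y, v (x i i) * y = 1} :=
    .and (.forall_finite fun i => .forall_finite fun j => .imp_const _ fun _ =>
      (Set.DefinableFun.var _).ofPred_eq .ring_zero)
      (.forall_finite fun i => .exists_elem
        ((Set.DefinableFun.ring_mul (.var _) (.var _)).ofPred_eq .ring_one))
  convert h using 3 with v
  constructor
  · rintro ⟨g, hg⟩
    refine ⟨fun i j hij => (hg i j).trans (toMatrix_eq_zero g hij), fun i => ?_⟩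
    obtain ⟨u, hu⟩ := isUnit_toMatrix_diag g i
    exact ⟨(u⁻¹ : Rˣ), by rw [hg, ← hu, Units.mul_inv]⟩
  · rintro ⟨h₁, h₂⟩
    exact ⟨ofMatrix (Matrix.of fun i j => v (x i j)) (fun i j hij => h₁ i j hij)
      fun i => IsUnit.of_mul_eq_one _ (h₂ i).choose_spec, fun i j => rfl⟩

theorem isInterpretation_groupCoord {n : ℕ} {P : Set R} :
    (CoordMap.ofInjective groupCoord (groupCoord_injective (n := n) (R := R))).IsInterpretation
      groupLanguage FirstOrder.Language.ring P := by
  have : ∀ k, IsEmpty (groupLanguage.Relations k) := fun k => ⟨fun r => r.elim⟩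
  refine CoordMap.isInterpretation_ofInjective _ ?_ ?_
  · convert definable_exists_toMatrix (P := P) (n := n) fun i j => finProdFinEquiv (i, j) using 1
    ext v
    exact exists_congr fun g =>
      (funext_iff.trans (forall_congr' fun _ => eq_comm)).trans (forall_eq_groupCoord_iff g v)
  · intro k F
    have hiff : ∀ (a : Fin k → upperTriangularGroup n R) (i : Fin k)
        (v : (Fin k × Fin (n * n)) ⊕ Fin (n * n) → R), (∀ e, v (.inl (i, e)) = groupCoord (a i) e) ↔
          ∀ x y, v (.inl (i, finProdFinEquiv (x, y))) = toMatrix (a i) x y :=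
      fun a i v => forall_eq_groupCoord_iff (a i) fun e => v (.inl (i, e))
    have hiff' : ∀ (g : upperTriangularGroup n R)
        (v : (Fin k × Fin (n * n)) ⊕ Fin (n * n) → R), (∀ e, v (.inr e) = groupCoord g e) ↔
          ∀ x y, v (.inr (finProdFinEquiv (x, y))) = toMatrix g x y :=
      fun g v => forall_eq_groupCoord_iff g fun e => v (.inr e)
    simp only [hiff, hiff']
    cases F with
    | mul =>
      have h : P.Definable FirstOrder.Language.ring
          {v : (Fin 2 × Fin (n * n)) ⊕ Fin (n * n) → R |
            (∃ g : upperTriangularGroup n R,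
              ∀ i j, v (.inl (0, finProdFinEquiv (i, j))) = toMatrix g i j) ∧
            (∃ g : upperTriangularGroup n R,
              ∀ i j, v (.inl (1, finProdFinEquiv (i, j))) = toMatrix g i j) ∧
            ∀ i j, v (.inr (finProdFinEquiv (i, j))) =
              ∑ k, v (.inl (0, finProdFinEquiv (i, k))) * v (.inl (1, finProdFinEquiv (k, j)))} :=
        .and (definable_exists_toMatrix _) (.and (definable_exists_toMatrix _)
          (.forall_finite fun i => .forall_finite fun j => (Set.DefinableFun.var _).ofPred_eq
            (.ring_sum _ fun k => .ring_mul (.var _) (.var _))))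
      convert h using 3 with v
      constructor
      · rintro ⟨a, ha, h⟩
        refine ⟨⟨_, ha 0⟩, ⟨_, ha 1⟩, fun i j => ?_⟩
        simp only [h, ha]
        rfl
      · rintro ⟨⟨a, ha⟩, ⟨b, hb⟩, h⟩
        refine ⟨![a, b], by simp [Fin.forall_fin_two, ha, hb], fun i j => ?_⟩
        simp only [h, ha, hb]
        rfl
    | inv =>
      -- Entries of the inverse are not given by terms of the ring language, so the inverse is
      -- characterized by the equation `g⁻¹ g = 1`.
      have h : P.Definable FirstOrder.Language.ring
          {v : (Fin 1 × Fin (n * n)) ⊕ Fin (n * n) → R |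
            (∃ g : upperTriangularGroup n R,
              ∀ i j, v (.inl (0, finProdFinEquiv (i, j))) = toMatrix g i j) ∧
            (∃ g : upperTriangularGroup n R,
              ∀ i j, v (.inr (finProdFinEquiv (i, j))) = toMatrix g i j) ∧
            ∀ i j, ∑ k, v (.inr (finProdFinEquiv (i, k))) * v (.inl (0, finProdFinEquiv (k, j))) =
              if i = j then 1 else 0} := by
        refine .and (definable_exists_toMatrix _) (.and (definable_exists_toMatrix _)
          (.forall_finite fun i => .forall_finite fun j => Set.DefinableFun.ofPred_eq
            (.ring_sum _ fun k => .ring_mul (.var _) (.var _)) ?_))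
        split_ifs
        · exact .ring_one
        · exact .ring_zero
      convert h using 3 with v
      constructor
      · rintro ⟨a, ha, h⟩
        refine ⟨⟨_, ha 0⟩, ⟨_, h⟩, fun i j => ?_⟩
        simp only [h, ha]
        exact congrFun (congrFun (toMatrix_inv_mul (a 0)) i) j
      · rintro ⟨⟨a, ha⟩, ⟨b, hb⟩, h⟩
        have hba : b = a⁻¹ := by
          rw [eq_inv_iff_mul_eq_one]
          apply toMatrix_injective
          ext i j
          rw [toMatrix_mul, Matrix.mul_apply, toMatrix_one, Matrix.one_apply, ← h]
          simp only [ha, hb]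
        subst hba
        exact ⟨![a], by simp [ha], hb⟩
    | one =>
      have h : P.Definable FirstOrder.Language.ring
          {v : (Fin 0 × Fin (n * n)) ⊕ Fin (n * n) → R |
            ∀ i j, v (.inr (finProdFinEquiv (i, j))) = if i = j then 1 else 0} := by
        refine .forall_finite fun i => .forall_finite fun j =>
          (Set.DefinableFun.var _).ofPred_eq ?_
        split_ifs
        · exact .ring_one
        · exact .ring_zero
      convert h using 3 with v
      exact ⟨fun ⟨a, _, h⟩ => h, fun h => ⟨![], fun i => i.elim0, h⟩⟩

/-- If `R ⧸ 2R` and `Rˣ` are finite, the ring `R` without parameters is bi-interpretable with the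
group `T_n(R)`, `n ≥ 3`, with parameters that generate it. -/
theorem biInterpretable_of_closure_eq_top [IsDomain R] (h2 : (2 : R) ≠ 0)
    [Finite (R ⧸ Ideal.span {(2 : R)})] [Finite Rˣ] (hQ : Subgroup.closure Q = ⊤) :
    BiInterpretable FirstOrder.Language.ring groupLanguage (A := R)
      (B := upperTriangularGroup (N + 3) R) ∅ Q := by
  refine ⟨1, _, CoordMap.ofInjective ringCoord ringCoord_injective,
    CoordMap.ofInjective groupCoord groupCoord_injective, isInterpretation_ringCoord h2 hQ,
    isInterpretation_groupCoord, CoordMap.hasDefinableIso_comp_ofInjective _ _ ?_,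
    CoordMap.hasDefinableIso_comp_ofInjective _ _ ?_⟩
  · refine .forall_finite fun i => .forall_finite fun e =>
      (Set.DefinableFun.var _).ofPred_eq ?_
    simp only [groupCoord, ringCoord, corner, toMatrix_transvection, Matrix.transvection,
      Matrix.add_apply, Matrix.one_apply, Matrix.single_apply]
    refine .ring_add ?_ ?_
    · split_ifs
      · exact .ring_one
      · exact .ring_zero
    · split_ifs
      · exact .var _
      · exact .ring_zero
  · have h := (entriesDefinable_univ h2 hQ).preimage_comp (fun o : Option _ =>
      o.map fun p : Fin (N + 3) × Fin (N + 3) => (finProdFinEquiv p, (0 : Fin 1)))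
    convert h using 1
    ext v
    simp only [Set.mem_ofPred_eq, Fin.forall_fin_one, Set.mem_preimage, Set.mem_univ, true_and,
      Function.comp_apply, Option.map_some, Option.map_none]
    rw [← finProdFinEquiv.forall_congr_right, Prod.forall]
    simp only [groupCoord_apply, ringCoord]

end upperTriangularGroup

/-! ### The case of rings of integers -/

theorem mainTheorem8 (K : Type*) [Field K] [NumberField K]
    [Finite (NumberField.RingOfIntegers K)ˣ]
    (n : ℕ) (hn : 3 ≤ n)
    (r : ℕ) (α : Fin r → (NumberField.RingOfIntegers K)ˣ)
    (hα : Subgroup.closure (Set.range α) = ⊤)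
    (m : ℕ) (β : Module.Basis (Fin m) ℤ (NumberField.RingOfIntegers K)) :
    BiInterpretable FirstOrder.Language.ring groupLanguage
      (A := NumberField.RingOfIntegers K)
      (B := upperTriangularGroup n (NumberField.RingOfIntegers K))
      ∅ (upperTriangularGroup.params n β α) := by
  obtain ⟨N, rfl⟩ := Nat.exists_eq_add_of_le' hn
  have h2 : (2 : NumberField.RingOfIntegers K) ≠ 0 := two_ne_zero
  -- A nonzero ideal has finite index, the ring of integers being free of finite rank over `ℤ`.
  have : Finite (NumberField.RingOfIntegers K ⧸
      Ideal.span {(2 : NumberField.RingOfIntegers K)}) :=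
    Ideal.finiteQuotientOfFreeOfNeBot _ (by simp)
  exact upperTriangularGroup.biInterpretable_of_closure_eq_top h2
    (upperTriangularGroup.closure_params_eq_top hα β.span_eq)
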